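/- Let $G$ be a countable discrete abelian group, written additively, and let $M$ be a subgroup of $G$ of finite index $L$, with a fixed set $\mathcal{L}=\{\ell_0,\dots,\ell_{L-1}\}$ of representatives of the cosets of $M$ in $G$, so that $G$ is the disjoint union of the cosets $\ell_r+M$, $r=0,\dots,L-1$. Let $\widehat{M}$ be the compact group of characters $\gamma:M\to\{z\in\mathbb{C}:|z|=1\}$, with $\langle m,\gamma\rangle:=\gamma(m)$, equipped with its Haar measure $d\gamma$ of total mass $1$. The $M$-Fourier transform of $c\in\ell^1(M)$ is $\widehat c(\gamma)=\sum_{m\in M}c(m)\overline{\langle m,\gamma\rangle}$; it extends uniquely from $\ell^1(M)$ to a unitary operator of $\ell^2(M)$ onto $L^2(\widehat{M})$, denoted in the same way. The polyphase transform is the unitary operator $\mathcal{P}:\ell^2(G)\to L^2(\widehat{M})^L$, $\mathcal{P}x=[X_\ell]_{\ell\in\mathcal{L}}$, where $X_\ell$ is the $M$-Fourier transform of $x_\ell(m)=x(m+\ell)$, $m\in M$. Let $h_1,\dots,h_K\in\ell^1(G)$, and let $\mathbf{H}(\gamma)=[H_{k,\ell}(\gamma)]$, $\gamma\in\widehat{M}$,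 be the $K\times L$ matrix (rows $k=1,\dots,K$, columns $\ell\in\mathcal{L}$) whose entry $H_{k,\ell}$ is the $M$-Fourier transform of $h_{k,\ell}(m)=h_k(m-\ell)$, $m\in M$. Let $f_k(n)=\overline{h_k(-n)}$ and $(T_mf)(n)=f(n-m)$ for $n\in G$, $m\in M$. Write $\mathbf{H}^*(\gamma)$ for the conjugate transpose of $\mathbf{H}(\gamma)$. (1) The family $\{T_mf_k\}_{1\le k\le K,\,m\in M}$ is a frame for $\ell^2(G)$, i.e. there are $0<A\le B$ with $A\|x\|_2^2\le\sum_{k=1}^K\sum_{m\in M}|\langle x,T_mf_k\rangle|^2\le B\|x\|_2^2$ for all $x\in\ell^2(G)$, if and only if $\operatorname{rank}\mathbf{H}(\gamma)=L$ for every $\gamma\in\widehat{M}$. (2) In this case the optimal frame bounds (the largest possible $A$ and the smallest possible $B$) are $$A=\min_{\gamma\in\widehat{M}}\lambda_{\min}(\gamma),\qquad B=\max_{\gamma\in\widehat{M}}\lambda_{\max}(\gamma),$$ where $\lambda_{\min}(\gamma)$ and $\lambda_{\max}(\gamma)$ are the smallest and the largest eigenvalue of $\mathbf{H}^*(\gamma)\mathbf{H}(\gamma)$;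 in particular this minimum and this maximum are attained. (3) In this case the canonical dual frame $\{S^{-1}T_mf_k\}_{1\le k\le K,\,m\in M}$, where $Sx=\sum_{k=1}^K\sum_{m\in M}\langle x,T_mf_k\rangle\,T_mf_k$ is the (invertible) frame operator on $\ell^2(G)$, is $\{T_m\overline{f}_k\}_{1\le k\le K,\,m\in M}$ with $\overline{f}_k=\mathcal{P}^{-1}(\mathbf{H}^*\mathbf{H})^{-1}\mathcal{P}f_k$; here $(\mathbf{H}^*\mathbf{H})^{-1}\mathcal{P}f_k\in L^2(\widehat{M})^L$ is the function $\gamma\mapsto(\mathbf{H}^*(\gamma)\mathbf{H}(\gamma))^{-1}(\mathcal{P}f_k)(\gamma)$, and $\overline{f}_k$ is just the name of this function, not a complex conjugate. -/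

import Mathlib

open MeasureTheory
open scoped ENNReal ComplexConjugate InnerProductSpace

noncomputable section

namespace FilterBank

/-! ### The dual group of a discrete abelian group and the Fourier transform -/

/-- The dual group of the (additively written) discrete group `A`: the compact group of all
characters of `A` (continuity is automatic since `A` is discrete). -/
abbrev DualGroup (A : Type*) [AddCommGroup A] [TopologicalSpace A] : Type _ :=
  PontryaginDual (Multiplicative A)

section Dual

variable {A : Type*} [AddCommGroup A] [TopologicalSpace A]

/-- The pairing `⟨a, γ⟩ = γ(a)` of a group element with a character. -/
def pairing (a : A) (γ : DualGroup A) : ℂ := ((γ (Multiplicative.ofAdd a) : Circle) : ℂ)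

instance instMeasurableSpaceDualGroup : MeasurableSpace (DualGroup A) := borel _

instance instBorelSpaceDualGroup : BorelSpace (DualGroup A) := ⟨rfl⟩

theorem pairing_zero (γ : DualGroup A) : pairing (0 : A) γ = 1 := by
  simp [pairing]

theorem pairing_add (a b : A) (γ : DualGroup A) :
    pairing (a + b) γ = pairing a γ * pairing b γ := by
  simp [pairing, ofAdd_add, map_mul]

theorem pairing_mul (a : A) (γ χ : DualGroup A) :
    pairing a (γ * χ) = pairing a γ * pairing a χ := by
  have h : (γ * χ) (Multiplicative.ofAdd a)
      = γ (Multiplicative.ofAdd a) * χ (Multiplicative.ofAdd a) := rfl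
  simp [pairing, h]

theorem norm_pairing (a : A) (γ : DualGroup A) : ‖pairing a γ‖ = 1 :=
  Circle.norm_coe _

theorem pairing_neg (a : A) (γ : DualGroup A) : pairing (-a) γ = conj (pairing a γ) := by
  unfold pairing
  rw [ofAdd_neg, map_inv, Circle.coe_inv_eq_conj]

theorem continuous_pairing (a : A) : Continuous (pairing a : DualGroup A → ℂ) := by
  have h : Continuous fun γ : DualGroup A => γ (Multiplicative.ofAdd a) := by
    have h1 : Continuous fun γ : (Multiplicative A) →ₜ* Circle => γ.toContinuousMap :=
      (ContinuousMonoidHom.isEmbedding_toContinuousMap (Multiplicative A) Circle).continuous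
    exact (continuous_eval_const (F := C(Multiplicative A, Circle))
      (Multiplicative.ofAdd a)).comp h1
  exact continuous_subtype_val.comp h

/-- The Haar measure of the compact dual group, normalized to have total mass one. -/
def dualHaar (A : Type*) [AddCommGroup A] [TopologicalSpace A] [DiscreteTopology A] :
    Measure (DualGroup A) :=
  Measure.haarMeasure ⊤

variable [DiscreteTopology A]

instance instIsHaarDualHaar : (dualHaar A).IsHaarMeasure := by
  unfold dualHaar; infer_instance

instance instIsProbabilityDualHaar : IsProbabilityMeasure (dualHaar A) :=
  ⟨by
    have := Measure.haarMeasure_self (K₀ := (⊤ : TopologicalSpace.PositiveCompacts (DualGroup A)))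
    simpa [dualHaar] using this⟩

instance instRegularDualHaar : (dualHaar A).Regular := by
  unfold dualHaar; infer_instance

/-- Characters separate the points of a discrete abelian group. -/
theorem exists_pairing_ne_one {a : A} (ha : a ≠ 0) : ∃ χ : DualGroup A, pairing a χ ≠ 1 := by
  obtain ⟨c, hc⟩ := CharacterModule.exists_character_apply_ne_zero_of_ne_zero ha
  let g : ℚ →+ Additive Circle :=
    { toFun := fun q => Additive.ofMul (Circle.exp (2 * Real.pi * (q : ℝ)))
      map_zero' := by simp
      map_add' := fun p q => by
        rw [← ofMul_mul, ← Circle.exp_add]; push_cast; ring_nf }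
  have hker : ∀ q : ℚ, g q = 0 ↔ q ∈ AddSubgroup.zmultiples (1 : ℚ) := by
    intro q
    have h0 : g q = 0 ↔ Circle.exp (2 * Real.pi * (q : ℝ)) = 1 := Iff.rfl
    rw [h0, Circle.exp_eq_one, AddSubgroup.mem_zmultiples_iff]
    refine exists_congr fun n => ?_
    have hpi := Real.pi_ne_zero
    constructor
    · intro h
      have h2 : (q : ℝ) = n := by
        have : (2 * Real.pi) * (q : ℝ) = (2 * Real.pi) * n := by rw [h]; ring
        exact mul_left_cancel₀ (by positivity) this
      simp only [zsmul_eq_mul, mul_one]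
      exact_mod_cast h2.symm
    · intro h
      simp only [zsmul_eq_mul, mul_one] at h
      rw [← h]; push_cast; ring
  let φ : AddCircle (1 : ℚ) →+ Additive Circle :=
    QuotientAddGroup.lift _ g fun q hq => (hker q).2 hq
  have hφ : ∀ t, φ t = 0 → t = 0 := by
    intro t
    induction t using QuotientAddGroup.induction_on with
    | H q =>
      intro h
      exact (QuotientAddGroup.eq_zero_iff q).2 ((hker q).1 h)
  let χ : (Multiplicative A) →ₜ* Circle :=
    { toFun := fun x => (φ (c x.toAdd)).toMul
      map_one' := by simp
      map_mul' := fun x y => by simp [map_add]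
      continuous_toFun := continuous_of_discreteTopology }
  refine ⟨χ, fun h => hc (hφ _ ?_)⟩
  have h1 : ((φ (c a)).toMul : Circle) = 1 := Circle.ext h
  exact h1

theorem integral_pairing {a : A} (ha : a ≠ 0) : ∫ γ, pairing a γ ∂(dualHaar A) = 0 := by
  obtain ⟨χ, hχ⟩ := exists_pairing_ne_one ha
  have h := integral_mul_left_eq_self (μ := dualHaar A) (fun γ => pairing a γ) χ
  simp only [pairing_mul, integral_const_mul] at h
  have h2 : (pairing a χ - 1) * ∫ γ, pairing a γ ∂(dualHaar A) = 0 := by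
    rw [sub_mul, h, one_mul, sub_self]
  exact (mul_eq_zero.1 h2).resolve_left (sub_ne_zero.2 hχ)

/-- The continuous function `γ ↦ conj ⟨a, γ⟩` on the dual group. -/
def expFun (a : A) : C(DualGroup A, ℂ) :=
  ⟨fun γ => conj (pairing a γ), Complex.continuous_conj.comp (continuous_pairing a)⟩

/-- The function `γ ↦ conj ⟨a, γ⟩` as an element of `L²` of the dual group. -/
def expL2 (a : A) : Lp ℂ 2 (dualHaar A) :=
  ContinuousMap.toLp (E := ℂ) 2 (dualHaar A) ℂ (expFun a)

theorem orthonormal_expL2 : Orthonormal ℂ (expL2 : A → Lp ℂ 2 (dualHaar A)) := by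
  classical
  rw [orthonormal_iff_ite]
  intro a b
  unfold expL2
  rw [ContinuousMap.inner_toLp (dualHaar A) (expFun a) (expFun b)]
  have h : ∀ γ : DualGroup A, expFun b γ * conj (expFun a γ) = pairing (a - b) γ := by
    intro γ
    simp only [expFun, ContinuousMap.coe_mk, Complex.conj_conj]
    rw [sub_eq_add_neg, pairing_add, pairing_neg, mul_comm]
  simp_rw [h]
  split_ifs with hab
  · subst hab
    simp [pairing_zero]
  · exact integral_pairing (sub_ne_zero.2 hab)

theorem span_expL2_dense :
    (Submodule.span ℂ (Set.range (expL2 : A → Lp ℂ 2 (dualHaar A)))).topologicalClosure = ⊤ := by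
  have hmul : ∀ a b : A, expFun a * expFun b = expFun (a + b) := fun a b => by
    ext γ; simp [expFun, pairing_add]
  let S : StarSubalgebra ℂ C(DualGroup A, ℂ) :=
    { toSubalgebra := Algebra.adjoin ℂ (Set.range (expFun : A → C(DualGroup A, ℂ)))
      star_mem' := by
        change Algebra.adjoin ℂ (Set.range (expFun : A → C(DualGroup A, ℂ))) ≤
          star (Algebra.adjoin ℂ (Set.range (expFun : A → C(DualGroup A, ℂ))))
        refine Algebra.adjoin_le ?_
        rintro - ⟨a, rfl⟩
        refine Algebra.subset_adjoin ⟨-a, ?_⟩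
        ext γ
        simp [expFun, pairing_neg] }
  have hS : Subalgebra.toSubmodule S.toSubalgebra
      = Submodule.span ℂ (Set.range (expFun : A → C(DualGroup A, ℂ))) := by
    apply Algebra.adjoin_eq_span_of_subset
    refine Set.Subset.trans ?_ Submodule.subset_span
    intro x hx
    refine Submonoid.closure_induction (fun _ => id) ⟨0, ?_⟩ ?_ hx
    · ext γ; simp [expFun, pairing_zero]
    · rintro - - - - ⟨a, rfl⟩ ⟨b, rfl⟩
      exact ⟨a + b, (hmul a b).symm⟩
  have hsep : S.SeparatesPoints := by
    intro γ χ hne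
    have : ∃ a : A, pairing a γ ≠ pairing a χ := by
      by_contra! hcon
      exact hne (PontryaginDual.ext fun x => Circle.ext (hcon x.toAdd))
    obtain ⟨a, ha⟩ := this
    refine ⟨_, ⟨expFun a, Algebra.subset_adjoin ⟨a, rfl⟩, rfl⟩, ?_⟩
    intro h
    exact ha ((starRingEnd ℂ).injective h)
  have htop := ContinuousMap.starSubalgebra_topologicalClosure_eq_top_of_separatesPoints S hsep
  have hspan : (Submodule.span ℂ (Set.range
      (expFun : A → C(DualGroup A, ℂ)))).topologicalClosure = ⊤ := by
    rw [← hS]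
    exact congr_arg (Subalgebra.toSubmodule <| StarSubalgebra.toSubalgebra ·) htop
  have h2 := (ContinuousMap.toLp_denseRange ℂ (dualHaar A) ℂ
    (p := 2) (by simp)).topologicalClosure_map_submodule hspan
  rw [Submodule.map_span, ← Set.range_comp] at h2
  exact h2

/-- The functions `γ ↦ conj ⟨a, γ⟩`, `a ∈ A`, form a Hilbert basis of `L²` of the dual group. -/
def expBasis (A : Type*) [AddCommGroup A] [TopologicalSpace A] [DiscreteTopology A] :
    HilbertBasis A ℂ (Lp ℂ 2 (dualHaar A)) :=
  HilbertBasis.mk orthonormal_expL2 span_expL2_dense.ge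

/-- The Fourier transform `ĉ(γ) = ∑ₐ c(a) conj ⟨a, γ⟩` of an absolutely summable function. -/
def fourierL1 (c : A → ℂ) (γ : DualGroup A) : ℂ := ∑' a, c a * conj (pairing a γ)

/-- The Fourier transform as a unitary operator of `ℓ²(A)` onto `L²` of the dual group. It maps
the unit vector at `a` to the function `γ ↦ conj ⟨a, γ⟩`. -/
def fourierL2 (A : Type*) [AddCommGroup A] [TopologicalSpace A] [DiscreteTopology A] :
    lp (fun _ : A => ℂ) 2 ≃ₗᵢ[ℂ] Lp ℂ 2 (dualHaar A) :=
  (expBasis A).repr.symm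

/-- On absolutely summable functions the unitary Fourier transform is given by the series. -/
theorem fourierL2_ae_eq (c : lp (fun _ : A => ℂ) 2) (hc : Memℓp (c : A → ℂ) 1) :
    (fourierL2 A c : DualGroup A → ℂ) =ᵐ[dualHaar A] fourierL1 (c : A → ℂ) := by
  have hs : Summable fun a => ‖c a‖ := by
    have := hc.summable (by simp)
    simpa using this
  have hnorm : ∀ a : A, ‖(expFun a : C(DualGroup A, ℂ))‖ ≤ 1 := fun a =>
    (ContinuousMap.norm_le _ zero_le_one).2 fun γ => by simp [expFun, norm_pairing]
  have hsum : Summable fun a => (c a) • (expFun a : C(DualGroup A, ℂ)) := by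
    refine Summable.of_norm_bounded hs fun a => ?_
    rw [norm_smul]
    exact mul_le_of_le_one_right (norm_nonneg _) (hnorm a)
  have h1 := (hsum.hasSum).mapL (ContinuousMap.toLp (E := ℂ) 2 (dualHaar A) ℂ)
  have h2 : HasSum (fun a => c a • (expL2 a : Lp ℂ 2 (dualHaar A))) (fourierL2 A c) := by
    have := (expBasis A).hasSum_repr_symm c
    simpa [expBasis, fourierL2] using this
  have h3 : fourierL2 A c = ContinuousMap.toLp (E := ℂ) 2 (dualHaar A) ℂ
      (∑' a, (c a) • (expFun a : C(DualGroup A, ℂ))) := by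
    refine h2.unique ?_
    simpa [expL2] using h1
  rw [h3]
  refine (ContinuousMap.coeFn_toLp _ _).trans (Filter.Eventually.of_forall fun γ => ?_)
  rw [← ContinuousMap.tsum_apply hsum γ]
  simp [fourierL1, expFun]

end Dual

/-! ### Frames in a complex Hilbert space -/

section Frames

variable {E : Type*} [NormedAddCommGroup E] [InnerProductSpace ℂ E] {ι : Type*}

/-- `A` and `B` are frame bounds of the family `f`:
`0 < A`, `0 < B` and `A ‖x‖² ≤ ∑ᵢ |⟨x, fᵢ⟩|² ≤ B ‖x‖²` for all `x`. -/
def HasFrameBounds (f : ι → E) (A B : ℝ) : Prop :=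
  0 < A ∧ 0 < B ∧ ∀ x : E, Summable (fun i => ‖⟪f i, x⟫_ℂ‖ ^ 2) ∧
    A * ‖x‖ ^ 2 ≤ ∑' i, ‖⟪f i, x⟫_ℂ‖ ^ 2 ∧ ∑' i, ‖⟪f i, x⟫_ℂ‖ ^ 2 ≤ B * ‖x‖ ^ 2

/-- The family `f` is a frame for `E`. -/
def IsFrame (f : ι → E) : Prop := ∃ A B : ℝ, HasFrameBounds f A B

/-- `A` and `B` are the optimal frame bounds of the family `f`: the largest lower
frame bound and the smallest upper frame bound. -/
def IsOptimalFrameBounds (f : ι → E) (A B : ℝ) : Prop :=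
  IsGreatest {a : ℝ | ∃ b, HasFrameBounds f a b} A ∧
    IsLeast {b : ℝ | ∃ a, HasFrameBounds f a b} B

/-- `g` is the canonical dual frame of `f`: the frame operator `S x = ∑ᵢ ⟨x, fᵢ⟩ fᵢ` is a bounded
invertible operator, and `gᵢ = S⁻¹ fᵢ` for all `i`. (The inner product of Mathlib is linear in the
second variable.) -/
def IsCanonicalDualFrame (f g : ι → E) : Prop :=
  ∃ S : E ≃L[ℂ] E, (∀ x : E, HasSum (fun i => ⟪f i, x⟫_ℂ • f i) (S x)) ∧
    ∀ i, g i = S.symm (f i)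

end Frames

/-! ### Polyphase analysis on a discrete abelian group -/

section Group

variable {G : Type*} [AddCommGroup G]

theorem memℓp_comp_injective {α β : Type*} {p : ℝ≥0∞} (hp : 0 < p.toReal) {x : β → ℂ}
    (hx : Memℓp (E := fun _ : β => ℂ) x p) {φ : α → β} (hφ : Function.Injective φ) :
    Memℓp (E := fun _ : α => ℂ) (fun a => x (φ a)) p := by
  have h := (hx.summable hp).comp_injective hφ
  exact memℓp_gen h

/-- The translation `(T_m f)(n) = f(n - m)` on `ℓ²(G)`. -/
def translateL2 (m : G) (f : lp (fun _ : G => ℂ) 2) : lp (fun _ : G => ℂ) 2 :=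
  ⟨fun n => f (n - m), memℓp_comp_injective (by simp) (lp.memℓp f) (sub_left_injective (b := m))⟩

/-- The involution `f̃(n) = conj (f(-n))` of a function on `G`. -/
def involution (f : G → ℂ) (n : G) : ℂ := conj (f (-n))

/-- The involution of a function of `ℓ¹(G)`, as an element of `ℓ²(G)`. -/
def involutionL2 (h : lp (fun _ : G => ℂ) 1) : lp (fun _ : G => ℂ) 2 :=
  ⟨involution h, by
    have h1 : Memℓp (E := fun _ : G => ℂ) (fun n : G => h (-n)) 1 :=
      memℓp_comp_injective (by simp) (lp.memℓp h) neg_injective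
    have h2 : Memℓp (E := fun _ : G => ℂ) (involution h) 1 := by
      refine memℓp_gen ?_
      simpa [involution] using h1.summable (by simp)
    exact h2.of_exponent_ge (by norm_num)⟩

/-- The system `{T_m f_k}`, `k = 1, …, K`, `m ∈ M`, of translates in `ℓ²(G)`. -/
def shiftedSystem {K : ℕ} (M : AddSubgroup G) (f : Fin K → lp (fun _ : G => ℂ) 2)
    (p : Fin K × M) : lp (fun _ : G => ℂ) 2 :=
  translateL2 (p.2 : G) (f p.1)

/-- `ell 0, …, ell (L - 1)` is a system of representatives of the cosets of `M`: every element of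
`G` lies in exactly one of the `L` cosets `ell r + M`. In particular `M` has finite index `L`. -/
def IsTransversal {L : ℕ} (M : AddSubgroup G) (ell : Fin L → G) : Prop :=
  ∀ n : G, ∃! r : Fin L, n - ell r ∈ M

variable {L : ℕ} {M : AddSubgroup G}

/-- The polyphase component `x_ℓ(m) = x(m + ℓ)`, `m ∈ M`, of `x ∈ ℓ²(G)`. -/
def polyphaseComponent (M : AddSubgroup G) (l : G) (x : lp (fun _ : G => ℂ) 2) :
    lp (fun _ : M => ℂ) 2 :=
  ⟨fun m => x ((m : G) + l), memℓp_comp_injective (by simp) (lp.memℓp x)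
    ((add_left_injective l).comp Subtype.val_injective)⟩

/-- The bijection `(r, m) ↦ m + ell r` of `Fin L × M` with `G`. -/
def transversalEquiv {ell : Fin L → G} (hell : IsTransversal M ell) : Fin L × M ≃ G :=
  Equiv.ofBijective (fun p => (p.2 : G) + ell p.1) (by
    constructor
    · rintro ⟨r, m⟩ ⟨s, n⟩ h
      simp only at h
      have hr : r = s := by
        refine (hell ((m : G) + ell r)).unique ?_ ?_
        · simp
        · rw [h]; simp
      subst hr
      have hm : m = n := Subtype.ext (add_right_cancel h)
      rw [hm]
    · intro n
      obtain ⟨r, hr, -⟩ := hell n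
      exact ⟨(r, ⟨n - ell r, hr⟩), by simp⟩)

theorem hasSum_norm_sq_lp {α : Type*} (y : lp (fun _ : α => ℂ) 2) :
    HasSum (fun a => ‖y a‖ ^ 2) (‖y‖ ^ 2) := by
  have := lp.hasSum_norm (p := 2) (by simp) y
  simpa using this

theorem norm_sq_eq_sum_polyphaseComponent {ell : Fin L → G} (hell : IsTransversal M ell)
    (x : lp (fun _ : G => ℂ) 2) :
    ‖x‖ ^ 2 = ∑ r : Fin L, ‖polyphaseComponent M (ell r) x‖ ^ 2 := by
  have h2 : HasSum (fun p : Fin L × M => ‖x ((p.2 : G) + ell p.1)‖ ^ 2) (‖x‖ ^ 2) :=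
    (Equiv.hasSum_iff (f := fun n : G => ‖x n‖ ^ 2) (transversalEquiv hell)).2
      (hasSum_norm_sq_lp x)
  have h3 : HasSum (fun r : Fin L => ‖polyphaseComponent M (ell r) x‖ ^ 2) (‖x‖ ^ 2) :=
    h2.prod_fiberwise fun r => hasSum_norm_sq_lp (polyphaseComponent M (ell r) x)
  exact h3.unique (hasSum_fintype _)

variable [TopologicalSpace G] [DiscreteTopology G]

/-- The polyphase transform `x ↦ [X_ℓ]_ℓ` as a function, where `X_ℓ` is the Fourier transform, with
respect to the group `M`, of the polyphase component `x_ℓ`. -/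
def polyphaseFun (M : AddSubgroup G) (ell : Fin L → G) (x : lp (fun _ : G => ℂ) 2) :
    PiLp 2 (fun _ : Fin L => Lp ℂ 2 (dualHaar M)) :=
  WithLp.toLp 2 fun r => fourierL2 M (polyphaseComponent M (ell r) x)

theorem polyphaseFun_add (ell : Fin L → G) (x y : lp (fun _ : G => ℂ) 2) :
    polyphaseFun M ell (x + y) = polyphaseFun M ell x + polyphaseFun M ell y := by
  ext1 r
  have h : polyphaseComponent M (ell r) (x + y)
      = polyphaseComponent M (ell r) x + polyphaseComponent M (ell r) y := rfl
  simp only [polyphaseFun, PiLp.add_apply]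
  rw [h, map_add]

theorem polyphaseFun_smul (ell : Fin L → G) (c : ℂ) (x : lp (fun _ : G => ℂ) 2) :
    polyphaseFun M ell (c • x) = c • polyphaseFun M ell x := by
  ext1 r
  have h : polyphaseComponent M (ell r) (c • x) = c • polyphaseComponent M (ell r) x := rfl
  simp only [polyphaseFun, PiLp.smul_apply]
  rw [h, LinearIsometryEquiv.map_smul]

theorem norm_polyphaseFun {ell : Fin L → G} (hell : IsTransversal M ell)
    (x : lp (fun _ : G => ℂ) 2) : ‖polyphaseFun M ell x‖ = ‖x‖ := by
  have h1 : ∀ r : Fin L, ‖polyphaseFun M ell x r‖ = ‖polyphaseComponent M (ell r) x‖ :=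
    fun r => (fourierL2 M).norm_map (polyphaseComponent M (ell r) x)
  rw [PiLp.norm_eq_of_L2, Finset.sum_congr rfl fun r _ => by rw [h1 r],
    ← norm_sq_eq_sum_polyphaseComponent hell x, Real.sqrt_sq (norm_nonneg _)]

/-- The polyphase transform as a linear isometry. -/
def polyphaseIsometry (ell : Fin L → G) (hell : IsTransversal M ell) :
    lp (fun _ : G => ℂ) 2 →ₗᵢ[ℂ] PiLp 2 (fun _ : Fin L => Lp ℂ 2 (dualHaar M)) where
  toFun := polyphaseFun M ell
  map_add' := polyphaseFun_add ell
  map_smul' := polyphaseFun_smul ell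
  norm_map' := norm_polyphaseFun hell

theorem polyphaseIsometry_surjective (ell : Fin L → G) (hell : IsTransversal M ell) :
    Function.Surjective (polyphaseIsometry ell hell) := by
  intro X
  let c : Fin L → lp (fun _ : M => ℂ) 2 := fun r => (fourierL2 M).symm (X r)
  let e := transversalEquiv hell
  let y : G → ℂ := fun n => c (e.symm n).1 (e.symm n).2
  have hy : ∀ p : Fin L × M, y (e p) = c p.1 p.2 := fun p => by simp [y]
  have hmem : Memℓp (E := fun _ : G => ℂ) y 2 := by
    refine memℓp_gen ?_
    rw [← e.summable_iff]
    have h1 : ∀ p : Fin L × M, ((fun n => ‖y n‖ ^ (2 : ℝ≥0∞).toReal) ∘ e) p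
        = ‖c p.1 p.2‖ ^ (2 : ℝ≥0∞).toReal := fun p => by simp [hy]
    rw [summable_congr h1]
    have hs : ∀ r : Fin L, Summable fun m : M => ‖c r m‖ ^ (2 : ℝ≥0∞).toReal := fun r =>
      (lp.memℓp (c r)).summable (by simp)
    refine (summable_prod_of_nonneg fun p => by positivity).2 ⟨hs, ?_⟩
    exact (hasSum_fintype _).summable
  refine ⟨⟨y, hmem⟩, ?_⟩
  have hc : ∀ r, polyphaseComponent M (ell r) ⟨y, hmem⟩ = c r := by
    intro r
    ext m
    exact hy (r, m)
  ext1 r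
  change fourierL2 M (polyphaseComponent M (ell r) ⟨y, hmem⟩) = X r
  rw [hc r]
  simp [c]

/-- The polyphase transform `𝒫`, a unitary operator of `ℓ²(G)` onto the `L`-fold product of `L²`
of the dual group of `M`. -/
def polyphaseTransform (ell : Fin L → G) (hell : IsTransversal M ell) :
    lp (fun _ : G => ℂ) 2 ≃ₗᵢ[ℂ] PiLp 2 (fun _ : Fin L => Lp ℂ 2 (dualHaar M)) :=
  LinearIsometryEquiv.ofSurjective (polyphaseIsometry ell hell)
    (polyphaseIsometry_surjective ell hell)

/-- The `K × L` polyphase matrix `H(γ) = [H_{k,ℓ}(γ)]` of the analysis filters, where `H_{k,ℓ}` is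
the Fourier transform, with respect to the group `M`, of `h_{k,ℓ}(m) = h_k(m - ℓ)`, `m ∈ M`. -/
def polyphaseMatrix {K : ℕ} (M : AddSubgroup G) (ell : Fin L → G)
    (h : Fin K → lp (fun _ : G => ℂ) 1) (γ : DualGroup M) : Matrix (Fin K) (Fin L) ℂ :=
  Matrix.of fun k r => fourierL1 (fun m : M => h k ((m : G) - ell r)) γ

end Group

/-! ### Extreme eigenvalues -/

section Eigenvalues

open scoped Matrix

variable {K L : ℕ}

/-- The smallest eigenvalue of `Hᴴ * H`. -/
def lambdaMin (H : Matrix (Fin K) (Fin L) ℂ) : ℝ :=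
  ⨅ r : Fin L, (Matrix.isHermitian_conjTranspose_mul_self H).eigenvalues r

/-- The largest eigenvalue of `Hᴴ * H`. -/
def lambdaMax (H : Matrix (Fin K) (Fin L) ℂ) : ℝ :=
  ⨆ r : Fin L, (Matrix.isHermitian_conjTranspose_mul_self H).eigenvalues r

end Eigenvalues

end FilterBank

end

open FilterBank
open scoped Matrix

/-! The polyphase transform `P` turns every object of the theorem into multiplication by a matrix of
continuous functions on the compact dual of `M`. Translation by `m ∈ M` becomes multiplication by
the scalar function `e_m(γ) = conj ⟨m, γ⟩`, and `P f_k` is the conjugate of the `k`-th row of `H`.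
Hence `⟨x, T_m f_k⟩` is the `m`-th coefficient of `(H P x)_k` in the orthonormal basis `(e_m)`
(`inner_shiftedSystem`), and Parseval's identity gives `∑ |⟨x, T_m f_k⟩|² = ‖H P x‖²`
(`hasSum_norm_inner_shiftedSystem_sq`).

Since `P` is onto, frame bounds for the system are the same as bounds for multiplication by `H` on
vector-valued `L²`. Because the `h_k` are in `ℓ¹`, the entries of `H` are continuous; because Haar
measure charges every nonempty open set, the `L²` bounds are equivalent to the bounds `a ‖v‖² ≤
‖H(γ) v‖² ≤ b ‖v‖²` for every `γ`, not only almost every one (`hasFrameBounds_iff`). At a fixed `γ`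
the best constants are the extreme eigenvalues of `H(γ)ᴴ H(γ)`, and the smallest is positive exactly
when `H(γ)` has rank `L`. Compactness of the dual supplies a uniform bound and the attained extrema.

Parseval's expansion also gives `P S P⁻¹ = Hᴴ H` as a multiplier
(`hasSum_polyphaseTransform_frameOperator`). Full rank makes `det (Hᴴ H)` a continuous function
without zeros, so the inverse is again a continuous multiplier. It commutes with the scalar
functions `e_m`, so `S⁻¹` commutes with the translations by `M`, which is the formula for the dual
frame. -/

noncomputable section

namespace FilterBank

/-! ### Matrices of continuous functions -/

section EvalMatrix

variable {D : Type*} [TopologicalSpace D] {m n o : Type*}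

/-- The value at a point of a matrix of continuous functions. -/
def evalMatrix (F : Matrix m n C(D, ℂ)) (x : D) : Matrix m n ℂ := Matrix.of fun i j => F i j x

theorem evalMatrix_mul [Fintype n] (F : Matrix m n C(D, ℂ)) (F' : Matrix n o C(D, ℂ)) (x : D) :
    evalMatrix (F * F') x = evalMatrix F x * evalMatrix F' x := by
  ext i j
  simp [evalMatrix, Matrix.mul_apply, ContinuousMap.sum_apply]

theorem evalMatrix_one [DecidableEq n] (x : D) :
    evalMatrix (1 : Matrix n n C(D, ℂ)) x = 1 := by
  ext i j
  by_cases h : i = j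
  · subst h; simp [evalMatrix]
  · simp [evalMatrix, Matrix.one_apply_ne h]

theorem evalMatrix_conjTranspose (F : Matrix m n C(D, ℂ)) (x : D) :
    evalMatrix Fᴴ x = (evalMatrix F x)ᴴ := by
  ext i j
  simp [evalMatrix, Matrix.conjTranspose_apply]

variable [Fintype n]

theorem det_evalMatrix [DecidableEq n] (F : Matrix n n C(D, ℂ)) (x : D) :
    (evalMatrix F x).det = F.det x := by
  simp [evalMatrix, Matrix.det_apply, ContinuousMap.sum_apply]

/-- A continuous function without zeros is a unit of the ring `C(D, ℂ)`. Working with matrices over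
this ring turns pointwise invertibility into an inverse matrix whose entries are automatically
continuous. -/
theorem isUnit_det_of_forall_evalMatrix [DecidableEq n] {F : Matrix n n C(D, ℂ)}
    (hF : ∀ x, (evalMatrix F x).det ≠ 0) : IsUnit F.det :=
  (ContinuousMap.isUnit_iff_forall_ne_zero _).2 fun x => det_evalMatrix F x ▸ hF x

theorem evalMatrix_inv [DecidableEq n] {F : Matrix n n C(D, ℂ)} (hF : IsUnit F.det) (x : D) :
    evalMatrix F⁻¹ x = (evalMatrix F x)⁻¹ := by
  symm
  apply Matrix.inv_eq_left_inv
  rw [← evalMatrix_mul, Matrix.nonsing_inv_mul _ hF, evalMatrix_one]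

theorem continuous_evalMatrix_mulVec [Fintype m] (F : Matrix m n C(D, ℂ)) :
    Continuous fun p : D × (n → ℂ) => ∑ i, ‖(evalMatrix F p.1 *ᵥ p.2) i‖ ^ 2 := by
  simp only [evalMatrix, Matrix.mulVec, dotProduct, Matrix.of_apply]
  fun_prop

theorem continuous_sum_norm_evalMatrix_mulVec [Fintype m] (F : Matrix m n C(D, ℂ)) (v : n → ℂ) :
    Continuous fun x => ∑ i, ‖(evalMatrix F x *ᵥ v) i‖ ^ 2 := by
  simp only [evalMatrix, Matrix.mulVec, dotProduct, Matrix.of_apply]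
  fun_prop

end EvalMatrix

/-! ### Square integrable vector-valued functions -/

section VectorL2

variable {D : Type*} [MeasurableSpace D] {μ : Measure D} {n : Type*} [Fintype n]

theorem ae_eq_sum {ι : Type*} (s : Finset ι) (X : ι → Lp ℂ 2 μ) :
    ((∑ i ∈ s, X i : Lp ℂ 2 μ) : D → ℂ) =ᵐ[μ] fun x => ∑ i ∈ s, X i x := by
  classical
  induction s using Finset.induction_on with
  | empty => exact Lp.coeFn_zero ℂ 2 μ
  | insert a s ha ih =>
    rw [Finset.sum_insert ha]
    filter_upwards [Lp.coeFn_add (X a) (∑ i ∈ s, X i), ih] with x h1 h2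
    rw [h1, Pi.add_apply, h2, Finset.sum_insert ha]

/-- The squared norm of an element of an `L²` space. -/
theorem norm_sq_eq_integral_norm_sq (X : Lp ℂ 2 μ) : ‖X‖ ^ 2 = ∫ x, ‖X x‖ ^ 2 ∂μ := by
  have h : ((‖X‖ ^ 2 : ℝ) : ℂ) = ((∫ x, ‖X x‖ ^ 2 ∂μ : ℝ) : ℂ) := by
    have h1 := inner_self_eq_norm_sq_to_K (𝕜 := ℂ) X
    rw [L2.inner_def] at h1
    push_cast
    refine Eq.trans h1.symm ?_
    rw [← integral_complex_ofReal]
    refine integral_congr_ae (Filter.Eventually.of_forall fun x => ?_)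
    simp only [inner_self_eq_norm_sq_to_K]
    simp
  exact_mod_cast h

theorem integrable_norm_sq (X : Lp ℂ 2 μ) : Integrable (fun x => ‖X x‖ ^ 2) μ :=
  (Lp.memLp X).integrable_norm_pow (by norm_num)

theorem integrable_sum_norm_sq (X : PiLp 2 (fun _ : n => Lp ℂ 2 μ)) :
    Integrable (fun x => ∑ j, ‖X j x‖ ^ 2) μ :=
  integrable_finsetSum _ fun j _ => integrable_norm_sq (X j)

theorem norm_sq_eq_integral_sum (X : PiLp 2 (fun _ : n => Lp ℂ 2 μ)) :
    ‖X‖ ^ 2 = ∫ x, ∑ j, ‖X j x‖ ^ 2 ∂μ := by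
  rw [PiLp.norm_sq_eq_of_L2, integral_finsetSum _ fun j _ => integrable_norm_sq (X j)]
  exact Finset.sum_congr rfl fun j _ => norm_sq_eq_integral_norm_sq (X j)

variable [IsFiniteMeasure μ]

/-- The vector-valued function equal to `v` on `s` and to zero elsewhere. -/
def indicatorVec (s : Set D) (hs : MeasurableSet s) (v : n → ℂ) :
    PiLp 2 (fun _ : n => Lp ℂ 2 μ) :=
  WithLp.toLp 2 fun j => indicatorConstLp 2 hs (measure_ne_top μ s) (v j)

theorem indicatorVec_ae_eq (s : Set D) (hs : MeasurableSet s) (v : n → ℂ) :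
    ∀ᵐ x ∂μ, ∀ j, indicatorVec (μ := μ) s hs v j x = s.indicator (fun _ => v j) x :=
  ae_all_iff.2 fun j =>
    indicatorConstLp_coeFn (hs := hs) (hμs := measure_ne_top μ s) (c := v j)

theorem norm_indicatorVec_sq (s : Set D) (hs : MeasurableSet s) (v : n → ℂ) :
    ‖indicatorVec (μ := μ) s hs v‖ ^ 2 = ∫ _ in s, ∑ j, ‖v j‖ ^ 2 ∂μ := by
  rw [norm_sq_eq_integral_sum, ← integral_indicator hs]
  refine integral_congr_ae ?_
  filter_upwards [indicatorVec_ae_eq (μ := μ) s hs v] with x hx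
  simp only [hx]
  by_cases h : x ∈ s <;> simp [h]

end VectorL2

/-! ### Multiplication operators on `L²` with continuous symbols -/

section Multipliers

variable {D : Type*} [TopologicalSpace D] [CompactSpace D] [MeasurableSpace D] [BorelSpace D]
  {μ : Measure D} [IsFiniteMeasure μ]

variable (μ) in
/-- The operator of multiplication by the continuous function `g` on `L²(μ)`. -/
def mulL2 (g : C(D, ℂ)) : Lp ℂ 2 μ →L[ℂ] Lp ℂ 2 μ :=
  (ContinuousLinearMap.mul ℂ ℂ).holderL μ ∞ 2 2 (ContinuousMap.toLp (E := ℂ) ∞ μ ℂ g)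

theorem mulL2_ae_eq (g : C(D, ℂ)) (X : Lp ℂ 2 μ) :
    (mulL2 μ g X : D → ℂ) =ᵐ[μ] fun x => g x * X x := by
  have h1 := (ContinuousLinearMap.mul ℂ ℂ).coeFn_holder (r := 2) (μ := μ)
    (ContinuousMap.toLp (E := ℂ) ∞ μ ℂ g) X
  filter_upwards [h1, ContinuousMap.coeFn_toLp (p := ∞) (𝕜 := ℂ) μ g] with x h1 h2
  rw [h2] at h1
  exact h1

theorem mulL2_sum {ι : Type*} (s : Finset ι) (g : ι → C(D, ℂ)) (X : Lp ℂ 2 μ) :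
    mulL2 μ (∑ i ∈ s, g i) X = ∑ i ∈ s, mulL2 μ (g i) X := by
  simp only [mulL2, map_sum, sum_apply]

theorem mulL2_zero (X : Lp ℂ 2 μ) : mulL2 μ (0 : C(D, ℂ)) X = 0 := by
  simp [mulL2]

theorem mulL2_one (X : Lp ℂ 2 μ) : mulL2 μ (1 : C(D, ℂ)) X = X := by
  apply Lp.ext
  filter_upwards [mulL2_ae_eq (1 : C(D, ℂ)) X] with x h
  simpa using h

theorem mulL2_mul (g g' : C(D, ℂ)) (X : Lp ℂ 2 μ) :
    mulL2 μ (g * g') X = mulL2 μ g (mulL2 μ g' X) := by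
  apply Lp.ext
  filter_upwards [mulL2_ae_eq (g * g') X, mulL2_ae_eq g (mulL2 μ g' X), mulL2_ae_eq g' X]
    with x h1 h2 h3
  rw [h1, h2, h3, ContinuousMap.mul_apply, mul_assoc]

theorem mulL2_toLp (g g' : C(D, ℂ)) :
    mulL2 μ g (ContinuousMap.toLp (E := ℂ) 2 μ ℂ g') =
      ContinuousMap.toLp (E := ℂ) 2 μ ℂ (g * g') := by
  apply Lp.ext
  filter_upwards [mulL2_ae_eq g (ContinuousMap.toLp (E := ℂ) 2 μ ℂ g'),
    ContinuousMap.coeFn_toLp (p := 2) (𝕜 := ℂ) μ g',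
    ContinuousMap.coeFn_toLp (p := 2) (𝕜 := ℂ) μ (g * g')] with x h1 h2 h3
  rw [h1, h2, h3, ContinuousMap.mul_apply]

/-- The polyphase components of `f_k` are the conjugates of the entries of `H`; moving the conjugate
across the inner product is what makes `H` itself act on `x`. -/
theorem inner_mulL2_star (g : C(D, ℂ)) (X Y : Lp ℂ 2 μ) :
    ⟪mulL2 μ (star g) X, Y⟫_ℂ = ⟪X, mulL2 μ g Y⟫_ℂ := by
  rw [L2.inner_def, L2.inner_def]
  refine integral_congr_ae ?_
  filter_upwards [mulL2_ae_eq (star g) X, mulL2_ae_eq g Y] with x h1 h2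
  rw [h1, h2]
  simp only [RCLike.inner_apply, ContinuousMap.star_apply, RCLike.star_def, map_mul,
    Complex.conj_conj]
  ring

variable {m n o : Type*} [Fintype n] [Fintype o]

variable (μ) in
/-- The operator of multiplication by a matrix of continuous functions. -/
def matMulL2 (F : Matrix m n C(D, ℂ)) :
    PiLp 2 (fun _ : n => Lp ℂ 2 μ) →L[ℂ] PiLp 2 (fun _ : m => Lp ℂ 2 μ) :=
  (PiLp.continuousLinearEquiv 2 ℂ (fun _ : m => Lp ℂ 2 μ)).symm.toContinuousLinearMap ∘L
    ContinuousLinearMap.pi fun i => ∑ j, mulL2 μ (F i j) ∘L PiLp.proj 2 (fun _ : n => Lp ℂ 2 μ) j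

theorem matMulL2_apply (F : Matrix m n C(D, ℂ)) (X : PiLp 2 (fun _ : n => Lp ℂ 2 μ)) (i : m) :
    matMulL2 μ F X i = ∑ j, mulL2 μ (F i j) (X j) := by
  simp [matMulL2]

theorem matMulL2_mul (F : Matrix m n C(D, ℂ)) (F' : Matrix n o C(D, ℂ))
    (X : PiLp 2 (fun _ : o => Lp ℂ 2 μ)) :
    matMulL2 μ (F * F') X = matMulL2 μ F (matMulL2 μ F' X) := by
  ext1 i
  simp only [matMulL2_apply, Matrix.mul_apply, mulL2_sum, mulL2_mul, map_sum]
  exact Finset.sum_comm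

theorem matMulL2_one [DecidableEq n] (X : PiLp 2 (fun _ : n => Lp ℂ 2 μ)) :
    matMulL2 μ (1 : Matrix n n C(D, ℂ)) X = X := by
  ext1 i
  rw [matMulL2_apply, Finset.sum_eq_single i]
  · rw [Matrix.one_apply_eq, mulL2_one]
  · intro j _ hj
    rw [Matrix.one_apply_ne' hj, mulL2_zero]
  · simp

/-- Writing a scalar multiplier as a scalar matrix lets translations be composed with other matrix
multipliers, and lets commutation be read off from matrix algebra. -/
theorem matMulL2_scalar [DecidableEq n] (g : C(D, ℂ)) (X : PiLp 2 (fun _ : n => Lp ℂ 2 μ))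
    (i : n) : matMulL2 μ (Matrix.scalar n g) X i = mulL2 μ g (X i) := by
  rw [matMulL2_apply, Finset.sum_eq_single i]
  · simp
  · intro j _ hj
    rw [Matrix.scalar_apply, Matrix.diagonal_apply_ne' _ hj, mulL2_zero]
  · simp

variable [Fintype m]

theorem matMulL2_ae_eq (F : Matrix m n C(D, ℂ)) (X : PiLp 2 (fun _ : n => Lp ℂ 2 μ)) :
    ∀ᵐ x ∂μ, ∀ i, matMulL2 μ F X i x = (evalMatrix F x *ᵥ fun j => X j x) i := by
  rw [ae_all_iff]
  intro i
  have h2 : ∀ᵐ x ∂μ, ∀ j, mulL2 μ (F i j) (X j) x = F i j x * X j x :=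
    ae_all_iff.2 fun j => mulL2_ae_eq _ _
  rw [matMulL2_apply]
  filter_upwards [ae_eq_sum Finset.univ fun j => mulL2 μ (F i j) (X j), h2] with x h1 h2
  rw [h1]
  simp [Matrix.mulVec, dotProduct, evalMatrix, h2]

theorem mul_norm_sq_le_norm_matMulL2_sq {F : Matrix m n C(D, ℂ)} {a : ℝ}
    (h : ∀ (x : D) (v : n → ℂ), a * ∑ j, ‖v j‖ ^ 2 ≤ ∑ i, ‖(evalMatrix F x *ᵥ v) i‖ ^ 2)
    (X : PiLp 2 (fun _ : n => Lp ℂ 2 μ)) : a * ‖X‖ ^ 2 ≤ ‖matMulL2 μ F X‖ ^ 2 := by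
  rw [norm_sq_eq_integral_sum, norm_sq_eq_integral_sum, ← integral_const_mul]
  refine integral_mono_ae ((integrable_sum_norm_sq X).const_mul a) (integrable_sum_norm_sq _) ?_
  filter_upwards [matMulL2_ae_eq F X] with x hx
  simpa only [hx] using h x fun j => X j x

theorem norm_matMulL2_sq_le_mul_norm_sq {F : Matrix m n C(D, ℂ)} {b : ℝ}
    (h : ∀ (x : D) (v : n → ℂ), ∑ i, ‖(evalMatrix F x *ᵥ v) i‖ ^ 2 ≤ b * ∑ j, ‖v j‖ ^ 2)
    (X : PiLp 2 (fun _ : n => Lp ℂ 2 μ)) : ‖matMulL2 μ F X‖ ^ 2 ≤ b * ‖X‖ ^ 2 := by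
  rw [norm_sq_eq_integral_sum, norm_sq_eq_integral_sum, ← integral_const_mul]
  refine integral_mono_ae (integrable_sum_norm_sq _) ((integrable_sum_norm_sq X).const_mul b) ?_
  filter_upwards [matMulL2_ae_eq F X] with x hx
  simpa only [hx] using h x fun j => X j x

theorem integrable_of_continuous {ψ : D → ℝ} (hψ : Continuous ψ) : Integrable ψ μ := by
  obtain ⟨C, hC⟩ := (isCompact_range hψ).isBounded.exists_norm_le
  exact Integrable.of_bound hψ.aestronglyMeasurable C
    (Filter.Eventually.of_forall fun y => hC _ ⟨y, rfl⟩)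

/-- A continuous function with nonnegative integral over each measurable set is nonnegative. -/
theorem nonneg_of_forall_setIntegral_nonneg [μ.IsOpenPosMeasure] {ψ : D → ℝ} (hψ : Continuous ψ)
    (h : ∀ s, MeasurableSet s → 0 ≤ ∫ x in s, ψ x ∂μ) (x : D) : 0 ≤ ψ x := by
  have h1 := ae_nonneg_of_forall_setIntegral_nonneg (integrable_of_continuous hψ) fun s hs _ => h s hs
  -- A set of full measure is dense because `μ` is positive on nonempty open sets; the set here is
  -- also closed, hence everything.
  have h2 : Dense {y | 0 ≤ ψ y} := Measure.dense_of_ae h1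
  have h3 : IsClosed {y | 0 ≤ ψ y} := isClosed_le continuous_const hψ
  have := h2.closure_eq
  rw [h3.closure_eq] at this
  exact this.symm.subset (Set.mem_univ x)

theorem norm_matMulL2_indicatorVec_sq (F : Matrix m n C(D, ℂ)) (s : Set D)
    (hs : MeasurableSet s) (v : n → ℂ) :
    ‖matMulL2 μ F (indicatorVec s hs v)‖ ^ 2 =
      ∫ x in s, ∑ i, ‖(evalMatrix F x *ᵥ v) i‖ ^ 2 ∂μ := by
  rw [norm_sq_eq_integral_sum, ← integral_indicator hs]
  refine integral_congr_ae ?_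
  filter_upwards [indicatorVec_ae_eq (μ := μ) s hs v, matMulL2_ae_eq F (indicatorVec s hs v)]
    with x hx hy
  simp only [hy, hx]
  by_cases h : x ∈ s
  · simp [h]
  · simp only [h, not_false_eq_true, Set.indicator_of_notMem]
    have : (fun _ : n => (0 : ℂ)) = 0 := rfl
    simp [this]

/-- Testing the `L²` inequality on the functions `v · 1_s` gives the integrated inequality over
every measurable `s`. Both integrands are continuous, so it holds at every point. -/
theorem lower_bound_evalMatrix [μ.IsOpenPosMeasure] {F : Matrix m n C(D, ℂ)} {a : ℝ}
    (h : ∀ X : PiLp 2 (fun _ : n => Lp ℂ 2 μ), a * ‖X‖ ^ 2 ≤ ‖matMulL2 μ F X‖ ^ 2)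
    (x : D) (v : n → ℂ) : a * ∑ j, ‖v j‖ ^ 2 ≤ ∑ i, ‖(evalMatrix F x *ᵥ v) i‖ ^ 2 := by
  have hc := continuous_sum_norm_evalMatrix_mulVec F v
  have hk : Continuous fun _ : D => a * ∑ j, ‖v j‖ ^ 2 := continuous_const
  have key := nonneg_of_forall_setIntegral_nonneg (μ := μ) (hc.sub hk) (fun s hs => ?_) x
  · exact sub_nonneg.1 key
  · have h1 := h (indicatorVec s hs v)
    rw [norm_indicatorVec_sq, norm_matMulL2_indicatorVec_sq, ← integral_const_mul] at h1
    have h2 := integral_sub (integrable_of_continuous (μ := μ) hc).integrableOn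
      (integrable_of_continuous (μ := μ) hk).integrableOn (μ := μ.restrict s)
    exact h2 ▸ sub_nonneg.2 h1

theorem upper_bound_evalMatrix [μ.IsOpenPosMeasure] {F : Matrix m n C(D, ℂ)} {a : ℝ}
    (h : ∀ X : PiLp 2 (fun _ : n => Lp ℂ 2 μ), ‖matMulL2 μ F X‖ ^ 2 ≤ a * ‖X‖ ^ 2)
    (x : D) (v : n → ℂ) : ∑ i, ‖(evalMatrix F x *ᵥ v) i‖ ^ 2 ≤ a * ∑ j, ‖v j‖ ^ 2 := by
  have hc := continuous_sum_norm_evalMatrix_mulVec F v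
  have hk : Continuous fun _ : D => a * ∑ j, ‖v j‖ ^ 2 := continuous_const
  have key := nonneg_of_forall_setIntegral_nonneg (μ := μ) (hk.sub hc) (fun s hs => ?_) x
  · exact sub_nonneg.1 key
  · have h1 := h (indicatorVec s hs v)
    rw [norm_indicatorVec_sq, norm_matMulL2_indicatorVec_sq, ← integral_const_mul] at h1
    have h2 := integral_sub (integrable_of_continuous (μ := μ) hk).integrableOn
      (integrable_of_continuous (μ := μ) hc).integrableOn (μ := μ.restrict s)
    exact h2 ▸ sub_nonneg.2 h1

end Multipliers

/-! ### Extreme eigenvalues and the Rayleigh quotient -/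

section Rayleigh

open scoped ComplexOrder

variable {K L : ℕ}

theorem rank_eq_iff_mulVec_eq_zero {H : Matrix (Fin K) (Fin L) ℂ} :
    H.rank = L ↔ ∀ v : Fin L → ℂ, H *ᵥ v = 0 → v = 0 := by
  have h1 := LinearMap.finrank_range_add_finrank_ker H.mulVecLin
  rw [Module.finrank_fin_fun] at h1
  have h2 : H.rank = Module.finrank ℂ (LinearMap.range H.mulVecLin) := rfl
  rw [← h2] at h1
  have h3 : H.rank = L ↔ Module.finrank ℂ (LinearMap.ker H.mulVecLin) = 0 := by omega
  rw [h3, Submodule.finrank_eq_zero, Submodule.eq_bot_iff]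
  rfl

theorem det_conjTranspose_mul_self_ne_zero {H : Matrix (Fin K) (Fin L) ℂ} (h : H.rank = L) :
    (Hᴴ * H).det ≠ 0 := by
  intro h0
  obtain ⟨v, hv, hv0⟩ := Matrix.exists_mulVec_eq_zero_iff.2 h0
  exact hv (rank_eq_iff_mulVec_eq_zero.1 h v
    ((Matrix.conjTranspose_mul_self_mulVec_eq_zero H v).1 hv0))

/-- The left side is `⟨v, Hᴴ H v⟩`; expanding this inner product in an orthonormal eigenbasis of `Hᴴ
H` gives the right side. Both Rayleigh bounds and their sharpness follow from this identity. -/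
theorem sum_norm_mulVec_sq_eq (H : Matrix (Fin K) (Fin L) ℂ) (v : EuclideanSpace ℂ (Fin L)) :
    ∑ k, ‖(H *ᵥ v) k‖ ^ 2 = ∑ r,
      (Matrix.isHermitian_conjTranspose_mul_self H).eigenvalues r *
        ‖⟪(Matrix.isHermitian_conjTranspose_mul_self H).eigenvectorBasis r, v⟫_ℂ‖ ^ 2 := by
  set hA := Matrix.isHermitian_conjTranspose_mul_self H
  have hin : ∀ u w : EuclideanSpace ℂ (Fin L),
      ⟪u, WithLp.toLp 2 ((Hᴴ * H) *ᵥ w)⟫_ℂ = star (H *ᵥ u) ⬝ᵥ (H *ᵥ w) := by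
    intro u w
    rw [EuclideanSpace.inner_eq_star_dotProduct, dotProduct_comm, ← Matrix.mulVec_mulVec,
      Matrix.star_mulVec, ← Matrix.dotProduct_mulVec]
  have hsymm : ∀ u w : EuclideanSpace ℂ (Fin L),
      ⟪u, WithLp.toLp 2 ((Hᴴ * H) *ᵥ w)⟫_ℂ = ⟪WithLp.toLp 2 ((Hᴴ * H) *ᵥ u), w⟫_ℂ := by
    intro u w
    rw [hin, ← inner_conj_symm _ w, hin, ← RCLike.star_def, Matrix.star_dotProduct]
  have hev : ∀ r, ⟪hA.eigenvectorBasis r, WithLp.toLp 2 ((Hᴴ * H) *ᵥ v)⟫_ℂ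
      = hA.eigenvalues r * ⟪hA.eigenvectorBasis r, v⟫_ℂ := by
    intro r
    have h1 : WithLp.toLp 2 ((Hᴴ * H) *ᵥ (hA.eigenvectorBasis r))
        = (hA.eigenvalues r : ℂ) • hA.eigenvectorBasis r := by
      rw [hA.mulVec_eigenvectorBasis r]
      ext i
      simp
    rw [hsymm, h1, inner_smul_left, Complex.conj_ofReal]
  have h1 : ((∑ k, ‖(H *ᵥ v) k‖ ^ 2 : ℝ) : ℂ) = ⟪v, WithLp.toLp 2 ((Hᴴ * H) *ᵥ v)⟫_ℂ := by
    rw [hin]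
    simp [dotProduct, ← Complex.conj_mul']
  have h2 := hA.eigenvectorBasis.sum_inner_mul_inner v (WithLp.toLp 2 ((Hᴴ * H) *ᵥ v))
  rw [← h1] at h2
  apply Complex.ofReal_injective
  rw [← h2]
  push_cast
  refine Finset.sum_congr rfl fun r _ => ?_
  rw [hev, ← Complex.conj_mul', inner_conj_symm]
  ring

theorem lambdaMin_mul_le (H : Matrix (Fin K) (Fin L) ℂ) (v : Fin L → ℂ) :
    lambdaMin H * ∑ r, ‖v r‖ ^ 2 ≤ ∑ k, ‖(H *ᵥ v) k‖ ^ 2 := by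
  have h := sum_norm_mulVec_sq_eq H (WithLp.toLp 2 v)
  have h2 := (Matrix.isHermitian_conjTranspose_mul_self H).eigenvectorBasis.sum_sq_norm_inner_right
    (WithLp.toLp 2 v)
  rw [EuclideanSpace.norm_sq_eq] at h2
  simp only at h h2
  rw [h, ← h2, Finset.mul_sum]
  refine Finset.sum_le_sum fun r _ => mul_le_mul_of_nonneg_right ?_ (by positivity)
  exact ciInf_le (Set.finite_range _).bddBelow r

theorem le_lambdaMax_mul (H : Matrix (Fin K) (Fin L) ℂ) (v : Fin L → ℂ) :
    ∑ k, ‖(H *ᵥ v) k‖ ^ 2 ≤ lambdaMax H * ∑ r, ‖v r‖ ^ 2 := by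
  have h := sum_norm_mulVec_sq_eq H (WithLp.toLp 2 v)
  have h2 := (Matrix.isHermitian_conjTranspose_mul_self H).eigenvectorBasis.sum_sq_norm_inner_right
    (WithLp.toLp 2 v)
  rw [EuclideanSpace.norm_sq_eq] at h2
  simp only at h h2
  rw [h, ← h2, Finset.mul_sum]
  refine Finset.sum_le_sum fun r _ => mul_le_mul_of_nonneg_right ?_ (by positivity)
  exact le_ciSup (Set.finite_range _).bddAbove r

theorem exists_eigenvalue_eq (H : Matrix (Fin K) (Fin L) ℂ) (r : Fin L) :
    ∃ v : Fin L → ℂ, ∑ s, ‖v s‖ ^ 2 = 1 ∧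
      ∑ k, ‖(H *ᵥ v) k‖ ^ 2 = (Matrix.isHermitian_conjTranspose_mul_self H).eigenvalues r := by
  set hA := Matrix.isHermitian_conjTranspose_mul_self H
  refine ⟨hA.eigenvectorBasis r, ?_, ?_⟩
  · rw [← EuclideanSpace.norm_sq_eq, hA.eigenvectorBasis.norm_eq_one, one_pow]
  · rw [sum_norm_mulVec_sq_eq, Finset.sum_eq_single r]
    · simp
    · intro s _ hs
      rw [hA.eigenvectorBasis.inner_eq_zero hs]
      simp
    · simp

/-- `L ≠ 0` is essential: for `L = 0` there is no unit vector, and the infimum over the empty family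
is only a default value. -/
theorem exists_eq_lambdaMin [NeZero L] (H : Matrix (Fin K) (Fin L) ℂ) :
    ∃ v : Fin L → ℂ, ∑ s, ‖v s‖ ^ 2 = 1 ∧ ∑ k, ‖(H *ᵥ v) k‖ ^ 2 = lambdaMin H := by
  obtain ⟨r, hr⟩ := exists_eq_ciInf_of_finite
    (f := (Matrix.isHermitian_conjTranspose_mul_self H).eigenvalues)
  obtain ⟨v, h1, h2⟩ := exists_eigenvalue_eq H r
  exact ⟨v, h1, h2.trans hr⟩

theorem exists_eq_lambdaMax [NeZero L] (H : Matrix (Fin K) (Fin L) ℂ) :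
    ∃ v : Fin L → ℂ, ∑ s, ‖v s‖ ^ 2 = 1 ∧ ∑ k, ‖(H *ᵥ v) k‖ ^ 2 = lambdaMax H := by
  obtain ⟨r, hr⟩ := exists_eq_ciSup_of_finite
    (f := (Matrix.isHermitian_conjTranspose_mul_self H).eigenvalues)
  obtain ⟨v, h1, h2⟩ := exists_eigenvalue_eq H r
  exact ⟨v, h1, h2.trans hr⟩

end Rayleigh

/-! ### Attainment of the extreme eigenvalues -/

section Attainment

/-- `Fin L → ℂ` carries the sup norm, so the Euclidean sphere is not a metric sphere there; it is
closed, and it lies in the closed unit ball of the sup norm. -/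
theorem isCompact_unitSphere (L : ℕ) : IsCompact {v : Fin L → ℂ | ∑ r, ‖v r‖ ^ 2 = 1} := by
  refine Metric.isCompact_of_isClosed_isBounded
    (isClosed_eq (by fun_prop) continuous_const) ?_
  refine (Metric.isBounded_closedBall (x := (0 : Fin L → ℂ)) (r := 1)).subset fun v hv => ?_
  rw [mem_closedBall_zero_iff, pi_norm_le_iff_of_nonneg zero_le_one]
  intro r
  have h1 : ‖v r‖ ^ 2 ≤ ∑ s, ‖v s‖ ^ 2 :=
    Finset.single_le_sum (f := fun s => ‖v s‖ ^ 2) (fun s _ => by positivity) (Finset.mem_univ r)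
  rw [show ∑ s, ‖v s‖ ^ 2 = 1 from hv] at h1
  exact (sq_le_one_iff₀ (norm_nonneg _)).1 h1

variable {K L : ℕ} [NeZero L]

theorem nonempty_unitSphere : {v : Fin L → ℂ | ∑ r, ‖v r‖ ^ 2 = 1}.Nonempty := by
  -- The matrix is irrelevant: only the unit vector is kept.
  obtain ⟨v, hv, -⟩ := exists_eq_lambdaMin (0 : Matrix (Fin 0) (Fin L) ℂ)
  exact ⟨v, hv⟩

/-- The value is `‖H v‖²` for some unit vector `v`, and full column rank means that `H` is
injective. -/
theorem lambdaMin_pos {H : Matrix (Fin K) (Fin L) ℂ} (hH : H.rank = L) :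
    0 < lambdaMin H := by
  obtain ⟨v, hv, hv'⟩ := exists_eq_lambdaMin H
  rw [← hv']
  refine (Finset.sum_nonneg fun k _ => sq_nonneg _).lt_of_ne fun h0 => ?_
  have h4 := (Finset.sum_eq_zero_iff_of_nonneg fun k _ => sq_nonneg ‖(H *ᵥ v) k‖).1 h0.symm
  have h5 : v = 0 := rank_eq_iff_mulVec_eq_zero.1 hH v <| by
    ext k
    simpa using h4 k (Finset.mem_univ k)
  simp [h5] at hv

theorem lambdaMin_le_lambdaMax (H : Matrix (Fin K) (Fin L) ℂ) :
    lambdaMin H ≤ lambdaMax H := by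
  obtain ⟨v, hv, hv'⟩ := exists_eq_lambdaMin H
  simpa [hv, hv'] using le_lambdaMax_mul H v

variable {D : Type*} [TopologicalSpace D] [CompactSpace D] [Nonempty D]

/-- Continuity of the eigenvalues in `x` is not needed. The function `(x, v) ↦ ‖F(x) v‖²` is
continuous on the compact product of `D` with the unit sphere; at a minimizer `(x, v)` its value
lies between `lambdaMin` at `x` and `lambdaMin` at any other point. -/
theorem exists_isLeast_lambdaMin (F : Matrix (Fin K) (Fin L) C(D, ℂ)) :
    ∃ A, IsLeast (Set.range fun x => lambdaMin (evalMatrix F x)) A := by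
  obtain ⟨⟨x, v⟩, hv, hmin⟩ := (isCompact_univ.prod (isCompact_unitSphere L)).exists_isMinOn
    (Set.univ_nonempty.prod nonempty_unitSphere) (continuous_evalMatrix_mulVec F).continuousOn
  refine ⟨_, ⟨x, rfl⟩, ?_⟩
  rintro - ⟨y, rfl⟩
  obtain ⟨w, hw, hwy⟩ := exists_eq_lambdaMin (evalMatrix F y)
  have h1 := lambdaMin_mul_le (evalMatrix F x) v
  rw [show ∑ r, ‖v r‖ ^ 2 = 1 from hv.2, mul_one] at h1
  exact h1.trans ((isMinOn_iff.1 hmin (y, w) ⟨Set.mem_univ _, hw⟩).trans_eq hwy)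

theorem exists_isGreatest_lambdaMax (F : Matrix (Fin K) (Fin L) C(D, ℂ)) :
    ∃ B, IsGreatest (Set.range fun x => lambdaMax (evalMatrix F x)) B := by
  obtain ⟨⟨x, v⟩, hv, hmax⟩ := (isCompact_univ.prod (isCompact_unitSphere L)).exists_isMaxOn
    (Set.univ_nonempty.prod nonempty_unitSphere) (continuous_evalMatrix_mulVec F).continuousOn
  refine ⟨_, ⟨x, rfl⟩, ?_⟩
  rintro - ⟨y, rfl⟩
  obtain ⟨w, hw, hwy⟩ := exists_eq_lambdaMax (evalMatrix F y)
  have h1 := le_lambdaMax_mul (evalMatrix F x) v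
  rw [show ∑ r, ‖v r‖ ^ 2 = 1 from hv.2, mul_one] at h1
  exact hwy.symm.trans_le ((isMaxOn_iff.1 hmax (y, w) ⟨Set.mem_univ _, hw⟩).trans h1)

end Attainment

/-! ### Fourier transforms and translations -/

section Fourier

variable {A : Type*} [AddCommGroup A] [TopologicalSpace A]

theorem continuous_fourierL1 {c : A → ℂ} (hc : Summable fun a => ‖c a‖) :
    Continuous (fourierL1 c) := by
  refine continuous_tsum (fun a => continuous_const.mul
    (Complex.continuous_conj.comp (continuous_pairing a))) hc fun a γ => ?_
  simp [norm_pairing]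

variable [DiscreteTopology A]

theorem mulL2_expFun_expL2 (a b : A) :
    mulL2 (dualHaar A) (expFun a) (expL2 b) = expL2 (a + b) := by
  rw [expL2, mulL2_toLp]
  have : expFun a * expFun b = expFun (a + b) := by
    ext γ; simp [expFun, pairing_add]
  rw [this, expL2]

theorem hasSum_fourierL2 (c : lp (fun _ : A => ℂ) 2) :
    HasSum (fun a => c a • (expL2 a : Lp ℂ 2 (dualHaar A))) (fourierL2 A c) := by
  simpa [expBasis, fourierL2] using (expBasis A).hasSum_repr_symm c

/-- Multiplication by `e_a` sends the basis vector `e_b` to `e_(a + b)`, so both sides are the sum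
of one series, up to the reindexing `b ↦ a + b`. -/
theorem fourierL2_translateL2 (a : A) (c : lp (fun _ : A => ℂ) 2) :
    fourierL2 A (translateL2 a c) = mulL2 (dualHaar A) (expFun a) (fourierL2 A c) := by
  have h1 := (hasSum_fourierL2 c).mapL (mulL2 (dualHaar A) (expFun a))
  simp only [map_smul, mulL2_expFun_expL2] at h1
  refine HasSum.unique ?_ h1
  have h2 := (Equiv.addLeft a).hasSum_iff.2 (hasSum_fourierL2 (translateL2 a c))
  refine h2.congr_fun fun b => ?_
  have h3 : (translateL2 a c) (a + b) = c (a + b - a) := rfl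
  rw [Function.comp_apply, Equiv.coe_addLeft, h3, add_sub_cancel_left]

theorem hasSum_norm_inner_expL2_sq (Z : Lp ℂ 2 (dualHaar A)) :
    HasSum (fun a : A => ‖⟪(expL2 a : Lp ℂ 2 (dualHaar A)), Z⟫_ℂ‖ ^ 2) (‖Z‖ ^ 2) := by
  have h := hasSum_norm_sq_lp ((expBasis A).repr Z)
  rw [LinearIsometryEquiv.norm_map] at h
  simpa [HilbertBasis.repr_apply_apply, expBasis] using h

theorem hasSum_inner_expL2_smul (Z : Lp ℂ 2 (dualHaar A)) :
    HasSum (fun a : A => ⟪(expL2 a : Lp ℂ 2 (dualHaar A)), Z⟫_ℂ • expL2 a) Z := by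
  have h := (expBasis A).hasSum_repr Z
  simpa [HilbertBasis.repr_apply_apply, expBasis] using h

end Fourier

/-! ### The polyphase transform of the filters -/

section Filters

variable {G : Type*} [AddCommGroup G] {M : AddSubgroup G} {L K : ℕ} {ell : Fin L → G}

theorem summable_polyphase_filter (M : AddSubgroup G) (h : lp (fun _ : G => ℂ) 1) (l : G) :
    Summable fun m : M => ‖h ((m : G) - l)‖ := by
  have h1 : Summable fun n : G => ‖h n‖ := by simpa using (lp.memℓp h).summable (by simp)
  exact h1.comp_injective (i := fun m : M => (m : G) - l)
    ((sub_left_injective (b := l)).comp Subtype.val_injective)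

/-- The element `0` lies in some coset, so there is at least one representative. This rules out the
degenerate extrema over an empty set of eigenvalues. -/
theorem neZero_of_isTransversal (hell : IsTransversal M ell) : NeZero L := by
  obtain ⟨r, -⟩ := (hell 0).exists
  exact ⟨fun h => (h ▸ r : Fin 0).elim0⟩

theorem polyphaseComponent_translateL2 (m : M) (l : G) (x : lp (fun _ : G => ℂ) 2) :
    polyphaseComponent M l (translateL2 (m : G) x) = translateL2 m (polyphaseComponent M l x) := by
  ext n
  change x ((n : G) + l - m) = x (((n - m : M) : G) + l)
  rw [AddSubgroup.coe_sub, add_sub_right_comm]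

variable [TopologicalSpace G]

/-- The substitution `m ↦ -m` exchanges `-(m + l)` for `m - l` and conjugates the character. This
explains the sign in `h_k(m - ℓ)`: with it, `P f_k` is the conjugate of a row of `H`. -/
theorem fourierL1_polyphase_involution (h : lp (fun _ : G => ℂ) 1) (l : G) (γ : DualGroup M) :
    fourierL1 (fun m : M => involution h ((m : G) + l)) γ =
      conj (fourierL1 (fun m : M => h ((m : G) - l)) γ) := by
  unfold fourierL1
  rw [Complex.conj_tsum, ← (Equiv.neg M).tsum_eq]
  refine tsum_congr fun m => ?_
  simp only [Equiv.neg_apply, involution, pairing_neg, map_mul, Complex.conj_conj,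
    AddSubgroup.coe_neg]
  rw [neg_add, neg_neg, ← sub_eq_add_neg]

/-- The polyphase matrix of the filters, as a matrix of continuous functions. -/
def polyphaseSymbol (M : AddSubgroup G) (ell : Fin L → G) (h : Fin K → lp (fun _ : G => ℂ) 1) :
    Matrix (Fin K) (Fin L) C(DualGroup M, ℂ) :=
  Matrix.of fun k r => ⟨fourierL1 fun m : M => h k ((m : G) - ell r),
    continuous_fourierL1 (summable_polyphase_filter M (h k) (ell r))⟩

theorem evalMatrix_polyphaseSymbol (h : Fin K → lp (fun _ : G => ℂ) 1) (γ : DualGroup M) :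
    evalMatrix (polyphaseSymbol M ell h) γ = polyphaseMatrix M ell h γ := rfl

variable [DiscreteTopology G]

theorem polyphaseTransform_apply (hell : IsTransversal M ell) (x : lp (fun _ : G => ℂ) 2)
    (r : Fin L) :
    polyphaseTransform ell hell x r = fourierL2 M (polyphaseComponent M (ell r) x) := rfl

theorem polyphaseTransform_involutionL2 (hell : IsTransversal M ell)
    (h : Fin K → lp (fun _ : G => ℂ) 1) (k : Fin K) (r : Fin L) :
    polyphaseTransform ell hell (involutionL2 (h k)) r =
      ContinuousMap.toLp (E := ℂ) 2 (dualHaar M) ℂ (star (polyphaseSymbol M ell h k r)) := by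
  rw [polyphaseTransform_apply]
  apply Lp.ext
  -- Absolute summability allows the unitary Fourier transform to be computed by the series.
  have h1 : Memℓp (polyphaseComponent M (ell r) (involutionL2 (h k)) : M → ℂ) 1 := by
    refine memℓp_gen ?_
    have h2 := (Equiv.neg M).summable_iff.2 (summable_polyphase_filter M (h k) (ell r))
    refine h2.congr fun m => ?_
    have h3 : (polyphaseComponent M (ell r) (involutionL2 (h k)) : M → ℂ) m =
      conj (h k (-((m : G) + ell r))) := rfl
    rw [h3]
    simp only [Function.comp_apply, Equiv.neg_apply, AddSubgroup.coe_neg, ENNReal.toReal_one,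
      Real.rpow_one, RCLike.norm_conj]
    rw [neg_add']
  filter_upwards [fourierL2_ae_eq _ h1, ContinuousMap.coeFn_toLp (p := 2) (𝕜 := ℂ) (dualHaar M)
    (star (polyphaseSymbol M ell h k r))] with γ h2 h3
  rw [h2, h3]
  exact fourierL1_polyphase_involution (h k) (ell r) γ

theorem polyphaseTransform_translateL2 (hell : IsTransversal M ell) (m : M)
    (x : lp (fun _ : G => ℂ) 2) :
    polyphaseTransform ell hell (translateL2 (m : G) x) =
      matMulL2 (dualHaar M) (Matrix.scalar (Fin L) (expFun m)) (polyphaseTransform ell hell x) := by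
  ext1 r
  rw [matMulL2_scalar, polyphaseTransform_apply, polyphaseTransform_apply,
    polyphaseComponent_translateL2, fourierL2_translateL2]

theorem polyphaseTransform_translateL2_involutionL2 (hell : IsTransversal M ell)
    (h : Fin K → lp (fun _ : G => ℂ) 1) (k : Fin K) (m : M) (r : Fin L) :
    polyphaseTransform ell hell (translateL2 (m : G) (involutionL2 (h k))) r =
      mulL2 (dualHaar M) (star (polyphaseSymbol M ell h k r)) (expL2 m) := by
  rw [polyphaseTransform_translateL2, matMulL2_scalar, polyphaseTransform_involutionL2,
    expL2, mulL2_toLp, mulL2_toLp, mul_comm]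

/-- The coefficients of `x` with respect to the translates of a filter are Fourier coefficients. -/
theorem inner_shiftedSystem (hell : IsTransversal M ell) (h : Fin K → lp (fun _ : G => ℂ) 1)
    (x : lp (fun _ : G => ℂ) 2) (p : Fin K × M) :
    ⟪shiftedSystem M (fun k => involutionL2 (h k)) p, x⟫_ℂ =
      ⟪expL2 p.2, matMulL2 (dualHaar M) (polyphaseSymbol M ell h)
        (polyphaseTransform ell hell x) p.1⟫_ℂ := by
  rw [← (polyphaseTransform ell hell).inner_map_map, PiLp.inner_apply, matMulL2_apply, inner_sum]
  refine Finset.sum_congr rfl fun r _ => ?_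
  rw [shiftedSystem, polyphaseTransform_translateL2_involutionL2, inner_mulL2_star]

/-- Summability on each fiber suffices because there are finitely many fibers: each is extended by
zero to the product, and the extensions are added. -/
theorem hasSum_prod_of_fiberwise {α : Type*} {E : Type*} [AddCommMonoid E] [TopologicalSpace E]
    [ContinuousAdd E] {g : Fin K × α → E} {a : Fin K → E}
    (hg : ∀ k, HasSum (fun m => g (k, m)) (a k)) : HasSum g (∑ k, a k) := by
  classical
  have h1 : ∀ k, HasSum (fun p : Fin K × α => if p.1 = k then g p else 0) (a k) := by
    intro k
    have hinj : Function.Injective (Prod.mk k : α → Fin K × α) := Prod.mk_right_injective k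
    rw [← hinj.hasSum_iff]
    · simpa [Function.comp_def] using hg k
    · rintro ⟨j, m⟩ hp
      refine if_neg fun hj => hp ⟨m, ?_⟩
      rw [← hj]
  have h2 := hasSum_sum (s := Finset.univ) fun k _ => h1 k
  simpa using h2

theorem hasSum_norm_inner_shiftedSystem_sq (hell : IsTransversal M ell)
    (h : Fin K → lp (fun _ : G => ℂ) 1) (x : lp (fun _ : G => ℂ) 2) :
    HasSum (fun p => ‖⟪shiftedSystem M (fun k => involutionL2 (h k)) p, x⟫_ℂ‖ ^ 2)
      (‖matMulL2 (dualHaar M) (polyphaseSymbol M ell h)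
        (polyphaseTransform ell hell x)‖ ^ 2) := by
  rw [PiLp.norm_sq_eq_of_L2]
  simp only [inner_shiftedSystem hell]
  set Z := matMulL2 (dualHaar M) (polyphaseSymbol M ell h) (polyphaseTransform ell hell x)
  exact hasSum_prod_of_fiberwise (g := fun p : Fin K × M => ‖⟪expL2 p.2, Z p.1⟫_ℂ‖ ^ 2)
    (a := fun k => ‖Z k‖ ^ 2) fun k => hasSum_norm_inner_expL2_sq (Z k)

/-- The frame sum is `‖H P x‖²` and `‖P x‖ = ‖x‖`. Surjectivity of `P` turns the frame inequality
into one for all vectors of `L²`, which is then localized; the converse is integration over `γ`. -/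
theorem hasFrameBounds_iff (hell : IsTransversal M ell) (h : Fin K → lp (fun _ : G => ℂ) 1)
    {a b : ℝ} :
    HasFrameBounds (shiftedSystem M fun k => involutionL2 (h k)) a b ↔ 0 < a ∧ 0 < b ∧
      ∀ (γ : DualGroup M) (v : Fin L → ℂ),
        a * ∑ r, ‖v r‖ ^ 2 ≤ ∑ k, ‖(polyphaseMatrix M ell h γ *ᵥ v) k‖ ^ 2 ∧
          ∑ k, ‖(polyphaseMatrix M ell h γ *ᵥ v) k‖ ^ 2 ≤ b * ∑ r, ‖v r‖ ^ 2 := by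
  have hs := hasSum_norm_inner_shiftedSystem_sq hell h
  refine and_congr_right fun _ => and_congr_right fun _ => ⟨fun H γ v => ?_, fun H x => ?_⟩
  · have H' : ∀ X, a * ‖X‖ ^ 2 ≤ ‖matMulL2 (dualHaar M) (polyphaseSymbol M ell h) X‖ ^ 2 ∧
        ‖matMulL2 (dualHaar M) (polyphaseSymbol M ell h) X‖ ^ 2 ≤ b * ‖X‖ ^ 2 := by
      intro X
      obtain ⟨x, rfl⟩ := (polyphaseTransform ell hell).surjective X
      have := (H x).2
      rwa [(hs x).tsum_eq, ← (polyphaseTransform ell hell).norm_map x] at this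
    exact ⟨lower_bound_evalMatrix (F := polyphaseSymbol M ell h) (fun X => (H' X).1) γ v,
      upper_bound_evalMatrix (F := polyphaseSymbol M ell h) (fun X => (H' X).2) γ v⟩
  · refine ⟨(hs x).summable, ?_⟩
    rw [(hs x).tsum_eq, ← (polyphaseTransform ell hell).norm_map x]
    exact ⟨mul_norm_sq_le_norm_matMulL2_sq (F := polyphaseSymbol M ell h) (fun γ v => (H γ v).1) _,
      norm_matMulL2_sq_le_mul_norm_sq (F := polyphaseSymbol M ell h) (fun γ v => (H γ v).2) _⟩

theorem rank_eq_of_isFrame (hell : IsTransversal M ell) (h : Fin K → lp (fun _ : G => ℂ) 1)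
    (hF : IsFrame (shiftedSystem M fun k => involutionL2 (h k))) (γ : DualGroup M) :
    (polyphaseMatrix M ell h γ).rank = L := by
  obtain ⟨a, b, hab⟩ := hF
  obtain ⟨ha, -, H⟩ := (hasFrameBounds_iff hell h).1 hab
  refine rank_eq_iff_mulVec_eq_zero.2 fun v hv => ?_
  have h1 := (H γ v).1
  rw [hv] at h1
  have h2 : ∑ r, ‖v r‖ ^ 2 ≤ 0 := by
    have h3 : a * ∑ r, ‖v r‖ ^ 2 ≤ 0 := by simpa using h1
    exact nonpos_of_mul_nonpos_right h3 ha
  have h4 := (Finset.sum_eq_zero_iff_of_nonneg fun r _ => sq_nonneg ‖v r‖).1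
    (h2.antisymm (Finset.sum_nonneg fun r _ => sq_nonneg ‖v r‖))
  ext r
  simpa using h4 r (Finset.mem_univ r)

/-- Optimality comes from attainment: at the extremal `γ`, a unit eigenvector for the extreme
eigenvalue forces the inequality on any other frame bound. -/
theorem exists_optimal_frame_bounds (hell : IsTransversal M ell)
    (h : Fin K → lp (fun _ : G => ℂ) 1) (hr : ∀ γ, (polyphaseMatrix M ell h γ).rank = L) :
    ∃ A B : ℝ,
      IsLeast (Set.range fun γ : DualGroup M => lambdaMin (polyphaseMatrix M ell h γ)) A ∧
      IsGreatest (Set.range fun γ : DualGroup M => lambdaMax (polyphaseMatrix M ell h γ)) B ∧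
      HasFrameBounds (shiftedSystem M fun k => involutionL2 (h k)) A B ∧
      IsOptimalFrameBounds (shiftedSystem M fun k => involutionL2 (h k)) A B := by
  have := neZero_of_isTransversal hell
  obtain ⟨A, hA⟩ := exists_isLeast_lambdaMin (polyphaseSymbol M ell h)
  obtain ⟨B, hB⟩ := exists_isGreatest_lambdaMax (polyphaseSymbol M ell h)
  simp only [evalMatrix_polyphaseSymbol] at hA hB
  have hAB : HasFrameBounds (shiftedSystem M fun k => involutionL2 (h k)) A B := by
    have hA0 : 0 < A := by
      obtain ⟨γ, rfl⟩ := hA.1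
      exact lambdaMin_pos (hr γ)
    -- Any character would serve for this comparison; the trivial one is at hand.
    have hB0 : A ≤ B := (hA.2 ⟨1, rfl⟩).trans
      ((lambdaMin_le_lambdaMax _).trans (hB.2 ⟨1, rfl⟩))
    refine (hasFrameBounds_iff hell h).2 ⟨hA0, hA0.trans_le hB0, fun γ v => ⟨?_, ?_⟩⟩
    · exact (mul_le_mul_of_nonneg_right (hA.2 ⟨γ, rfl⟩)
        (Finset.sum_nonneg fun r _ => sq_nonneg _)).trans (lambdaMin_mul_le _ v)
    · exact (le_lambdaMax_mul _ v).trans (mul_le_mul_of_nonneg_right (hB.2 ⟨γ, rfl⟩)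
        (Finset.sum_nonneg fun r _ => sq_nonneg _))
  refine ⟨A, B, hA, hB, hAB, ⟨⟨B, hAB⟩, ?_⟩, ⟨⟨A, hAB⟩, ?_⟩⟩
  · rintro a ⟨b, hab⟩
    obtain ⟨γ, rfl⟩ := hA.1
    obtain ⟨v, hv, hv'⟩ := exists_eq_lambdaMin (polyphaseMatrix M ell h γ)
    have := (((hasFrameBounds_iff hell h).1 hab).2.2 γ v).1
    rwa [hv, hv', mul_one] at this
  · rintro b ⟨a, hab⟩
    obtain ⟨γ, rfl⟩ := hB.1
    obtain ⟨v, hv, hv'⟩ := exists_eq_lambdaMax (polyphaseMatrix M ell h γ)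
    have := (((hasFrameBounds_iff hell h).1 hab).2.2 γ v).2
    rwa [hv, hv', mul_one] at this

/-- The frame operator is multiplication by `Hᴴ * H` in the polyphase domain. -/
theorem hasSum_polyphaseTransform_frameOperator (hell : IsTransversal M ell)
    (h : Fin K → lp (fun _ : G => ℂ) 1) (x : lp (fun _ : G => ℂ) 2) :
    HasSum (fun p => ⟪shiftedSystem M (fun k => involutionL2 (h k)) p, x⟫_ℂ •
        polyphaseTransform ell hell (shiftedSystem M (fun k => involutionL2 (h k)) p))
      (matMulL2 (dualHaar M) ((polyphaseSymbol M ell h)ᴴ * polyphaseSymbol M ell h)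
        (polyphaseTransform ell hell x)) := by
  rw [matMulL2_mul]
  set Z := matMulL2 (dualHaar M) (polyphaseSymbol M ell h) (polyphaseTransform ell hell x)
  have hcoord : ∀ r : Fin L, HasSum
      (fun p => (⟪shiftedSystem M (fun k => involutionL2 (h k)) p, x⟫_ℂ •
        polyphaseTransform ell hell (shiftedSystem M (fun k => involutionL2 (h k)) p)) r)
      (matMulL2 (dualHaar M) (polyphaseSymbol M ell h)ᴴ Z r) := by
    intro r
    rw [matMulL2_apply]
    refine hasSum_prod_of_fiberwise fun k => ?_
    -- Expand `Z k` in the basis `e_m` and multiply by the entry `(r, k)` of `Hᴴ`. This entry is the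
    -- conjugate of `H_{k,r}`, and its product with `e_m` is the `r`-th component of `P (T_m f_k)`.
    have h1 := (hasSum_inner_expL2_smul (Z k)).mapL
      (mulL2 (dualHaar M) ((polyphaseSymbol M ell h)ᴴ r k))
    refine h1.congr_fun fun m => ?_
    rw [PiLp.smul_apply, inner_shiftedSystem hell, shiftedSystem,
      polyphaseTransform_translateL2_involutionL2, map_smul]
    rfl
  have h2 : HasSum (fun p => WithLp.ofLp (⟪shiftedSystem M (fun k => involutionL2 (h k)) p, x⟫_ℂ •
        polyphaseTransform ell hell (shiftedSystem M (fun k => involutionL2 (h k)) p)))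
      (WithLp.ofLp (matMulL2 (dualHaar M) (polyphaseSymbol M ell h)ᴴ Z)) := Pi.hasSum.2 hcoord
  exact h2.mapL (PiLp.continuousLinearEquiv 2 ℂ
    (fun _ : Fin L => Lp ℂ 2 (dualHaar M))).symm.toContinuousLinearMap

/-- Multiplication by an invertible matrix of continuous functions. -/
def matMulL2Equiv {n : Type*} [Fintype n] [DecidableEq n] (Q : Matrix n n C(DualGroup M, ℂ))
    (hQ : IsUnit Q.det) :
    PiLp 2 (fun _ : n => Lp ℂ 2 (dualHaar M)) ≃L[ℂ] PiLp 2 (fun _ : n => Lp ℂ 2 (dualHaar M)) :=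
  ContinuousLinearEquiv.equivOfInverse (matMulL2 (dualHaar M) Q) (matMulL2 (dualHaar M) Q⁻¹)
    (fun X => by rw [← matMulL2_mul, Matrix.nonsing_inv_mul _ hQ, matMulL2_one])
    (fun X => by rw [← matMulL2_mul, Matrix.mul_nonsing_inv _ hQ, matMulL2_one])

/-- The frame operator is `P⁻¹ Q P` with `Q = Hᴴ H`, so its inverse is `P⁻¹ Q⁻¹ P`; the inverse over
`C(DualGroup M, ℂ)` evaluates to the pointwise inverse matrix. -/
theorem exists_canonicalDualFrame (hell : IsTransversal M ell)
    (h : Fin K → lp (fun _ : G => ℂ) 1) (hr : ∀ γ, (polyphaseMatrix M ell h γ).rank = L) :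
    ∃ Y : Fin K → PiLp 2 (fun _ : Fin L => Lp ℂ 2 (dualHaar M)),
      (∀ k, ∀ᵐ γ ∂(dualHaar M), ∀ r : Fin L,
        Y k r γ =
          (((polyphaseMatrix M ell h γ)ᴴ * polyphaseMatrix M ell h γ)⁻¹ *ᵥ
            fun s : Fin L => polyphaseTransform ell hell (involutionL2 (h k)) s γ) r) ∧
      IsCanonicalDualFrame (shiftedSystem M fun k => involutionL2 (h k))
        (shiftedSystem M fun k => (polyphaseTransform ell hell).symm (Y k)) := by
  set Q := (polyphaseSymbol M ell h)ᴴ * polyphaseSymbol M ell h with hQdef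
  have hev : ∀ γ, evalMatrix Q γ = (polyphaseMatrix M ell h γ)ᴴ * polyphaseMatrix M ell h γ := by
    intro γ
    rw [hQdef, evalMatrix_mul, evalMatrix_conjTranspose, evalMatrix_polyphaseSymbol]
  have hQ : IsUnit Q.det := isUnit_det_of_forall_evalMatrix fun γ => by
    rw [hev]
    exact det_conjTranspose_mul_self_ne_zero (hr γ)
  set P := polyphaseTransform ell hell
  refine ⟨fun k => matMulL2 (dualHaar M) Q⁻¹ (P (involutionL2 (h k))), fun k => ?_, ?_⟩
  · filter_upwards [matMulL2_ae_eq Q⁻¹ (P (involutionL2 (h k)))] with γ hγ r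
    rw [hγ r, evalMatrix_inv hQ, hev]
  · refine ⟨(P.toContinuousLinearEquiv.trans (matMulL2Equiv Q hQ)).trans
      P.symm.toContinuousLinearEquiv, fun x => ?_, fun p => ?_⟩
    · have h1 := (hasSum_polyphaseTransform_frameOperator hell h x).mapL
        P.symm.toContinuousLinearEquiv.toContinuousLinearMap
      simp only [map_smul, ContinuousLinearEquiv.coe_coe,
        LinearIsometryEquiv.coe_toContinuousLinearEquiv, P,
        LinearIsometryEquiv.symm_apply_apply] at h1
      exact h1
    -- After applying `P`, the claim that `S⁻¹` commutes with translation by `m` says that the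
    -- scalar matrix of `e_m` commutes with `Q⁻¹`.
    · apply P.injective
      change P (translateL2 (p.2 : G) _) = P (P.symm (matMulL2 (dualHaar M) Q⁻¹
        (P (translateL2 (p.2 : G) (involutionL2 (h p.1))))))
      rw [P.apply_symm_apply, polyphaseTransform_translateL2, polyphaseTransform_translateL2,
        ← matMulL2_mul, P.apply_symm_apply, ← matMulL2_mul]
      congr 2
      exact (Matrix.scalar_commute _ (fun g => Commute.all _ g) _).eq

end Filters

end FilterBank

end
theorem theorem3 {G : Type*} [AddCommGroup G] [Countable G] [TopologicalSpace G]
    [DiscreteTopology G] (M : AddSubgroup G) {L K : ℕ} (ell : Fin L → G)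
    (hell : IsTransversal M ell) (h : Fin K → lp (fun _ : G => ℂ) 1)
    (f : Fin K → lp (fun _ : G => ℂ) 2) (hf : ∀ k, f k = involutionL2 (h k)) :
    (IsFrame (shiftedSystem M f) ↔
      ∀ γ : DualGroup M, (polyphaseMatrix M ell h γ).rank = L) ∧
    (IsFrame (shiftedSystem M f) →
      (∃ A B : ℝ,
        IsLeast (Set.range fun γ : DualGroup M => lambdaMin (polyphaseMatrix M ell h γ)) A ∧
        IsGreatest (Set.range fun γ : DualGroup M => lambdaMax (polyphaseMatrix M ell h γ)) B ∧
        IsOptimalFrameBounds (shiftedSystem M f) A B) ∧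
      ∃ Y : Fin K → PiLp 2 (fun _ : Fin L => MeasureTheory.Lp ℂ 2 (dualHaar M)),
        (∀ k, ∀ᵐ γ ∂(dualHaar M), ∀ r : Fin L,
          Y k r γ =
            (((polyphaseMatrix M ell h γ)ᴴ * polyphaseMatrix M ell h γ)⁻¹ *ᵥ
              fun s : Fin L => polyphaseTransform ell hell (f k) s γ) r) ∧
        IsCanonicalDualFrame (shiftedSystem M f)
          (shiftedSystem M fun k => (polyphaseTransform ell hell).symm (Y k))) := by
  obtain rfl : f = fun k => involutionL2 (h k) := funext hf
  refine ⟨⟨rank_eq_of_isFrame hell h, fun hr => ?_⟩, fun hF => ?_⟩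
  · obtain ⟨A, B, -, -, hAB, -⟩ := exists_optimal_frame_bounds hell h hr
    exact ⟨A, B, hAB⟩
  · have hr := rank_eq_of_isFrame hell h hF
    obtain ⟨A, B, hA, hB, -, hAB⟩ := exists_optimal_frame_bounds hell h hr
    exact ⟨⟨A, B, hA, hB, hAB⟩, exists_canonicalDualFrame hell h hr⟩
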